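/- **Setting.** Let $X$ be a metric space, let $f_0,\dots,f_{m-1}\in X$ be potential median locations and $c_0,\dots,c_{n-1}\in X$ clients (points may coincide), and assume that all distances between these points are integers. For $k\ge 1$ and $1\le t\le n$, the $k$-median instance at time $t$ consists of the clients $c_0,\dots,c_{t-1}$ and of the set $F_t$ of the potential medians available at time $t$; the cost of a nonempty $S\subseteq F_t$ is $\mathrm{cost}_t(S)=\sum_{j<t}\min_{i\in S}d(c_j,i)$, and $\mathrm{opt}_t$ is the minimum of $\mathrm{cost}_t(S)$ over nonempty $S\subseteq F_t$ with $|S|\le k$. In the *static* setting $F_t=\{f_0,\dots,f_{m-1}\}$ for all $t$, with $m\ge 1$; after $t$ arrivals the online algorithm knows $k$, $m$ and the distances of the arrived clients to the potential medians. In the *$F=C$* setting $F_t=\{c_0,\dots,c_{t-1}\}$; after $t$ arrivals the online algorithm knows $k$ and the distances between the arrived clients. Potential medians are counted by their index. A deterministic online algorithm is a computable function that maps what is known after $t$ arrivals to a set $S_t\subseteq F_t$ (in particular it does not know $n$ or future clients); its total recourse is $\sum_{t=1}^{n}|S_t\setminus S_{t-1}|$, where $S_0=\emptyset$. Let $D$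 be the diameter of the set of all points of the instance. **Theorem.** There are absolute constants $\alpha$ and $B$ such that in each of the two settings there is a deterministic online algorithm for consistent $k$-median (without outliers) with the following guarantee on every such instance. At every time $1\le t\le n$ it maintains exactly $\min(k,|F_t|)$ medians $S_t\subseteq F_t$ with $\mathrm{cost}_t(S_t)\le\alpha\cdot\mathrm{opt}_t$; and if $n\ge 2$ and $D>0$, then its total recourse is at most $B\,k^2\,\log n\,\log(nD)$. -/

import Mathlib

namespace ConsistentKMedian

/-- All distances between points of `P` are (nonnegative) integers. -/
def IntegerDistances {X : Type*} [MetricSpace X] (P : Set X) : Prop :=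
  ∀ x ∈ P, ∀ y ∈ P, ∃ a : ℕ, dist x y = (a : ℝ)

/-- The points of an instance with potential median locations `F 0, …, F (m - 1)` and clients
`c 0, …, c (n - 1)`.  The values of `F` and `c` at other indices play no role anywhere. -/
def points {X : Type*} (F c : ℕ → X) (m n : ℕ) : Set X :=
  F '' Set.Iio m ∪ c '' Set.Iio n

/-- The cost `∑ j < t, d(c j, S)` of opening the medians `F i`, `i ∈ S`, for the first `t` clients.
`Metric.infDist` to a finite nonempty set is the distance to its nearest point; this is only
used for nonempty `S`. -/
noncomputable def cost {X : Type*} [MetricSpace X] (F c : ℕ → X) (t : ℕ) (S : Finset ℕ) : ℝ :=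
  ∑ j ∈ Finset.range t, Metric.infDist (c j) (F '' (S : Set ℕ))

/-- The optimum of the `k`-median instance with potential medians `F 0, …, F (m - 1)` and clients
`c 0, …, c (t - 1)`: the least cost of a (nonempty) set of at most `k` medians. -/
noncomputable def opt {X : Type*} [MetricSpace X] (F c : ℕ → X) (k m t : ℕ) : ℝ :=
  sInf {x : ℝ | ∃ S : Finset ℕ,
    S ⊆ Finset.range m ∧ S.Nonempty ∧ S.card ≤ k ∧ x = cost F c t S}

/-- Total recourse `∑_{t = 1}^{n} |S_t \ S_{t-1}|`, where `S_0 = ∅`, so that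
the medians opened at time `1` are charged as well. -/
def totalRecourse (S : ℕ → Finset ℕ) (n : ℕ) : ℕ :=
  (S 1).card + ∑ t ∈ Finset.Ico 1 n, (S (t + 1) \ S t).card

/-- What has been revealed after `t` arrivals when the set of potential medians is static:
for every arrived client the list of its distances to the `m` potential medians.
The distances are integers, so that taking the floor only changes the type. -/
noncomputable def revealedStatic {X : Type*} [MetricSpace X] (F c : ℕ → X) (m t : ℕ) :
    List (List ℕ) :=
  (List.range t).map fun j => (List.range m).map fun i => ⌊dist (c j) (F i)⌋₊

/-- What has been revealed after `t` arrivals when the potential medians are the arrived clients: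
for every arrived client the list of its distances to the clients that arrived before it. -/
noncomputable def revealedSelf {X : Type*} [MetricSpace X] (c : ℕ → X) (t : ℕ) :
    List (List ℕ) :=
  (List.range t).map fun j => (List.range j).map fun i => ⌊dist (c j) (c i)⌋₊

/-- The guarantee for a sequence of solutions `S 1, …, S n`, where after the `t`-th arrival the
potential medians are `F 0, …, F (m t - 1)` and the clients are `c 0, …, c (t - 1)`.
At all times `S t` consists of `min k (m t)` of the available medians and its
cost is at most `α` times the current optimum; the total recourse is at most
`B * k ^ 2 * log n * log (n * D)`, where `D` is the diameter of the whole instance. -/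
structure Guarantee {X : Type*} [MetricSpace X] (F c : ℕ → X) (k n : ℕ) (m : ℕ → ℕ)
    (α B : ℝ) (S : ℕ → Finset ℕ) : Prop where
  feasible : ∀ t ∈ Finset.Icc 1 n, S t ⊆ Finset.range (m t) ∧ (S t).card = min k (m t)
  approx : ∀ t ∈ Finset.Icc 1 n, cost F c t (S t) ≤ α * opt F c k (m t) t
  recourse : 2 ≤ n → 0 < Metric.diam (points F c (m n) n) →
    (totalRecourse S n : ℝ) ≤
      B * (k : ℝ) ^ 2 * Real.log n * Real.log (n * Metric.diam (points F c (m n) n))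

/-- A deterministic online algorithm for the static setting with approximation ratio `α` and
recourse constant `B`.  Its input after `t` arrivals is the number `k`, the number `m` of potential
medians and the distances revealed so far; its output lists the indices of the chosen medians. -/
def StaticAlgorithm.{u} (α B : ℝ) (A : ℕ × ℕ × List (List ℕ) → List ℕ) : Prop :=
  Computable A ∧
  ∀ (X : Type u) [MetricSpace X] (F c : ℕ → X) (k m n : ℕ), 1 ≤ k → 1 ≤ m →
    IntegerDistances (points F c m n) →
    Guarantee F c k n (fun _ => m) α B
      (fun t => (A (k, m, revealedStatic F c m t)).toFinset)

/-- A deterministic online algorithm for the setting in which every client that arrives also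
becomes a potential median, and there are no others.  Its input after `t` arrivals is the
number `k` and the distances revealed so far. -/
def SelfAlgorithm.{u} (α B : ℝ) (A : ℕ × List (List ℕ) → List ℕ) : Prop :=
  Computable A ∧
  ∀ (X : Type u) [MetricSpace X] (c : ℕ → X) (k n : ℕ), 1 ≤ k →
    IntegerDistances (points c c n n) →
    Guarantee c c k n (fun t => t) α B
      (fun t => (A (k, revealedSelf c t)).toFinset)

end ConsistentKMedian

/-! The algorithm is lazy: it keeps its medians until their number is wrong or their cost exceeds 8
times the optimum, and then switches to an optimum found by exhaustive search. A switch opens at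
most `k` medians, so it suffices that there are O(k log n log(nD)) switches. A switch forced by the
size lengthens the solution, so at most `k` of these occur.

For the switches caused by the cost, time is cut into phases by the binary logarithm of the running
maximum `peak` of the optimum. It is at most nD, which leaves O(log(nD)) phases. The potential is
the current cost divided by 2^phase. The optimum is within a factor 2 of `peak`, so replacing a
solution that is worse than 8-approximate lowers the potential by at least 1; the number of switches
is thus bounded by the total growth of the potential (`Regular.step`, `Regular.card_late_le`).

To bound the growth, let O be an optimum at the end of the phase and S the current solution. If r >
0 earlier clients share the O-cluster of the new client t, the triangle inequality through each of
them, averaged, gives d(t, S) ≤ d(t, O) + (cost O + cost S) / r (`Regular.rank_mul_near_le`). Both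
costs are O(2^phase), so each of the at most `k` clusters contributes a harmonic sum, and a phase
contributes O(k log n) (`Regular.sum_phase_le`).

The two settings share this analysis through `Regular`. When clients are the medians the optimum may
decrease over time, but only by a factor 2 (`regular_self`). -/

namespace ConsistentKMedian

/-! ### The algorithm -/

/-- A minimizer of `f` on a nonempty list. -/
def argmin {β : Type*} [Inhabited β] (f : β → ℕ) (l : List β) : β :=
  l.foldr (fun a b => if f a ≤ f b then a else b) l.headI

/-- The least value of `w` on a nonempty list. -/
def near (w : ℕ → ℕ) (S : List ℕ) : ℕ := w (argmin w S)

/-- The cost of the medians `S` for the first `t` clients, where `w j i` is the distance between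
client `j` and median `i`. -/
def listCost (w : ℕ → ℕ → ℕ) (t : ℕ) (S : List ℕ) : ℕ := ∑ j ∈ Finset.range t, near (w j) S

/-- All subsets of `{0, …, m - 1}`, as decreasing lists. -/
def subsets (m : ℕ) : List (List ℕ) :=
  Nat.rec [[]] (fun i L => L ++ L.map (List.cons i)) m

/-- All subsets of `{0, …, m - 1}` with `r` elements, as decreasing lists. -/
def candidates (r m : ℕ) : List (List ℕ) := (subsets m).filter (fun S => S.length = r)

/-- An optimal set of `min k m` medians. -/
def best (k m : ℕ) (w : ℕ → ℕ → ℕ) (t : ℕ) : List ℕ :=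
  argmin (listCost w t) (candidates (min k m) m)

/-- The cost of an optimal set of `min k m` medians. -/
def bestCost (k m : ℕ) (w : ℕ → ℕ → ℕ) (t : ℕ) : ℕ := listCost w t (best k m w t)

/-- The online algorithm: keep the current solution as long as it has the right size and is
`8`-approximate, and otherwise switch to an optimal one. -/
def sol (k : ℕ) (m : ℕ → ℕ) (w : ℕ → ℕ → ℕ) (t : ℕ) : List ℕ :=
  Nat.rec [] (fun t S =>
    if S.length = min k (m (t + 1)) ∧
        listCost w (t + 1) S ≤ 8 * bestCost k (m (t + 1)) w (t + 1)
    then S else best k (m (t + 1)) w (t + 1)) t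

lemma sol_zero (k : ℕ) (m : ℕ → ℕ) (w : ℕ → ℕ → ℕ) : sol k m w 0 = [] := rfl

lemma sol_succ (k : ℕ) (m : ℕ → ℕ) (w : ℕ → ℕ → ℕ) (t : ℕ) :
    sol k m w (t + 1) =
      if (sol k m w t).length = min k (m (t + 1)) ∧
          listCost w (t + 1) (sol k m w t) ≤ 8 * bestCost k (m (t + 1)) w (t + 1)
      then sol k m w t else best k (m (t + 1)) w (t + 1) := rfl

/-! ### Computability -/

section Computability

open Primrec

variable {σ β : Type*} [Primcodable σ] [Primcodable β]

lemma primrec_argmin [Inhabited β] {f : σ → β → ℕ} {l : σ → List β}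
    (hf : Primrec₂ f) (hl : Primrec l) : Primrec fun p => argmin (f p) (l p) := by
  refine Primrec.list_foldr (h := fun p q => if f p q.1 ≤ f p q.2 then q.1 else q.2)
    hl (Primrec.list_headI.comp hl) ?_
  refine Primrec.ite (Primrec.nat_le.comp (hf.comp fst (fst.comp snd))
    (hf.comp fst (snd.comp snd))) (fst.comp snd) (snd.comp snd)

lemma primrec_near {w : σ → ℕ → ℕ} {S : σ → List ℕ} (hw : Primrec₂ w) (hS : Primrec S) :
    Primrec fun p => near (w p) (S p) :=
  hw.comp Primrec.id (primrec_argmin hw hS)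

lemma primrec_listCost {w : σ → ℕ → ℕ → ℕ} {t : σ → ℕ} {S : σ → List ℕ}
    (hw : Primrec fun q : σ × ℕ × ℕ => w q.1 q.2.1 q.2.2) (ht : Primrec t) (hS : Primrec S) :
    Primrec fun p => listCost (w p) (t p) (S p) := by
  have hn : Primrec₂ fun (p : σ) (q : ℕ × ℕ) => q.2 + near (w p q.1) (S p) := by
    refine Primrec.nat_add.comp (snd.comp snd) ?_
    refine primrec_near (w := fun (x : σ × ℕ × ℕ) i => w x.1 x.2.1 i) ?_ (hS.comp fst)
    exact hw.comp (pair (fst.comp fst) (pair (fst.comp (snd.comp fst)) snd))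
  refine (Primrec.nat_rec' ht (Primrec.const 0) hn).of_eq fun p => ?_
  simp only [listCost]
  induction t p with
  | zero => rfl
  | succ j ih => rw [Finset.sum_range_succ, ← ih]

lemma primrec_subsets : Primrec subsets := by
  refine Primrec.nat_rec₁ [[]] ?_
  refine Primrec.list_append.comp snd (Primrec.list_map snd ?_)
  exact Primrec.list_cons.comp (fst.comp fst) snd

lemma primrec_candidates : Primrec₂ candidates := by
  have h : PrimrecRel fun (S : List ℕ) (r : ℕ) => S.length = r :=
    Primrec.eq.comp (Primrec.list_length.comp fst) snd
  exact h.listFilter.comp (primrec_subsets.comp snd) fst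

variable {k : σ → ℕ} {m t : σ → ℕ} {w : σ → ℕ → ℕ → ℕ}

lemma primrec_best (hk : Primrec k) (hm : Primrec m)
    (hw : Primrec fun q : σ × ℕ × ℕ => w q.1 q.2.1 q.2.2) (ht : Primrec t) :
    Primrec fun p => best (k p) (m p) (w p) (t p) := by
  refine primrec_argmin ?_ (primrec_candidates.comp (Primrec.nat_min.comp hk hm) hm)
  refine primrec_listCost (w := fun (x : σ × List ℕ) => w x.1) ?_ (ht.comp fst) snd
  exact hw.comp (pair (fst.comp fst) snd)

lemma primrec_sol {m : σ → ℕ → ℕ} (hk : Primrec k) (hm : Primrec₂ m)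
    (hw : Primrec fun q : σ × ℕ × ℕ => w q.1 q.2.1 q.2.2) (ht : Primrec t) :
    Primrec fun p => sol (k p) (m p) (w p) (t p) := by
  refine Primrec.nat_rec' (h := fun p (q : ℕ × List ℕ) =>
    if q.2.length = min (k p) (m p (q.1 + 1)) ∧
        listCost (w p) (q.1 + 1) q.2 ≤ 8 * bestCost (k p) (m p (q.1 + 1)) (w p) (q.1 + 1)
    then q.2 else best (k p) (m p (q.1 + 1)) (w p) (q.1 + 1)) ht (Primrec.const []) ?_
  have ht' : Primrec fun x : σ × ℕ × List ℕ => x.2.1 + 1 :=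
    Primrec.succ.comp (fst.comp snd)
  have hm' : Primrec fun x : σ × ℕ × List ℕ => m x.1 (x.2.1 + 1) := hm.comp fst ht'
  have hk' : Primrec fun x : σ × ℕ × List ℕ => k x.1 := hk.comp fst
  have hw' : Primrec fun y : (σ × ℕ × List ℕ) × ℕ × ℕ => w y.1.1 y.2.1 y.2.2 :=
    hw.comp (pair (fst.comp fst) snd)
  have hb := primrec_best (w := fun x : σ × ℕ × List ℕ => w x.1) hk' hm' hw' ht'
  refine Primrec.ite (PrimrecPred.and ?_ ?_) (snd.comp snd) hb
  · exact Primrec.eq.comp (Primrec.list_length.comp (snd.comp snd)) (Primrec.nat_min.comp hk' hm')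
  · refine Primrec.nat_le.comp
      (primrec_listCost (w := fun x : σ × ℕ × List ℕ => w x.1) hw' ht' (snd.comp snd)) ?_
    exact Primrec.nat_mul.comp (Primrec.const 8)
      (primrec_listCost (w := fun x : σ × ℕ × List ℕ => w x.1) hw' ht' hb)

end Computability

/-! ### Basic properties of the algorithm -/

lemma argmin_mem_cons {β : Type*} (f : β → ℕ) (l : List β) {d : β} :
    l.foldr (fun a b => if f a ≤ f b then a else b) d ∈ d :: l := by
  induction l with
  | nil => simp
  | cons a l ih =>
    simp only [List.foldr_cons, List.mem_cons] at ih ⊢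
    split_ifs <;> tauto

section Argmin

variable {β : Type*} [Inhabited β] {f g : β → ℕ} {l : List β}

lemma argmin_mem (f : β → ℕ) (hl : l ≠ []) : argmin f l ∈ l := by
  have h := argmin_mem_cons f l (d := l.headI)
  rcases List.mem_cons.1 h with h | h
  · unfold argmin
    rw [h]
    cases l with
    | nil => exact absurd rfl hl
    | cons a l => simp
  · exact h

lemma apply_argmin_le {a : β} (ha : a ∈ l) : f (argmin f l) ≤ f a := by
  unfold argmin
  generalize l.headI = d
  induction l with
  | nil => simp at ha
  | cons b l ih =>
    simp only [List.foldr_cons]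
    rcases List.mem_cons.1 ha with rfl | h
    · split_ifs with h
      · rfl
      · omega
    · have := ih h
      split_ifs with h
      · omega
      · omega

lemma argmin_congr (h : ∀ a ∈ l, f a = g a) : argmin f l = argmin g l := by
  cases l with
  | nil => rfl
  | cons a l =>
    unfold argmin
    generalize hd : (a :: l).headI = d
    have hd' : d = a := by simpa using hd.symm
    clear hd
    -- The induction varies the list but fixes the start value `d`; `f` and `g` agree there too,
    -- because `d` is the head of the original list.
    have key : ∀ L : List β, (∀ b ∈ L, f b = g b) →
        L.foldr (fun a b => if f a ≤ f b then a else b) d =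
          L.foldr (fun a b => if g a ≤ g b then a else b) d := by
      intro L
      induction L with
      | nil => simp
      | cons b L ih =>
        intro hL
        have ih' := ih fun c hc => hL c (List.mem_cons_of_mem _ hc)
        have hm := argmin_mem_cons g L (d := d)
        simp only [List.foldr_cons]
        rw [ih', hL b (by simp)]
        have : f (L.foldr (fun a b => if g a ≤ g b then a else b) d) =
            g (L.foldr (fun a b => if g a ≤ g b then a else b) d) := by
          rcases List.mem_cons.1 hm with e | e
          · rw [e, hd']; exact h a (by simp)
          · exact hL _ (List.mem_cons_of_mem _ e)
        rw [this]
    exact key _ h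

end Argmin

/-! ### Nearest medians and enumeration of subsets -/

section Lists

variable {w w' : ℕ → ℕ} {S T : List ℕ} {i m r : ℕ}

lemma near_le (hi : i ∈ S) : near w S ≤ w i := apply_argmin_le hi

lemma near_anti (hS : S ≠ []) (h : S ⊆ T) : near w T ≤ near w S :=
  near_le (h (argmin_mem w hS))

lemma near_congr (hS : S ≠ []) (h : ∀ i ∈ S, w i = w' i) : near w S = near w' S := by
  unfold near
  rw [argmin_congr h]
  exact h _ (argmin_mem _ hS)

lemma subsets_succ (m : ℕ) : subsets (m + 1) = subsets m ++ (subsets m).map (List.cons m) := rfl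

lemma mem_subsets (hS : S ∈ subsets m) : S.Nodup ∧ ∀ i ∈ S, i < m := by
  induction m generalizing S with
  | zero =>
    have : S = [] := by simpa [subsets] using hS
    simp [this]
  | succ m ih =>
    rw [subsets_succ, List.mem_append, List.mem_map] at hS
    rcases hS with h | ⟨T, hT, rfl⟩
    · exact ⟨(ih h).1, fun i hi => ((ih h).2 i hi).trans (Nat.lt_succ_self m)⟩
    · refine ⟨List.nodup_cons.2 ⟨fun h => lt_irrefl _ ((ih hT).2 m h), (ih hT).1⟩, fun i hi => ?_⟩
      rcases List.mem_cons.1 hi with rfl | h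
      · exact Nat.lt_succ_self _
      · exact ((ih hT).2 i h).trans (Nat.lt_succ_self m)

lemma exists_mem_subsets {U : Finset ℕ} (hU : U ⊆ Finset.range m) :
    ∃ S ∈ subsets m, S.toFinset = U := by
  induction m generalizing U with
  | zero => exact ⟨[], by simp [subsets], by simpa [eq_comm] using hU⟩
  | succ m ih =>
    obtain ⟨S, hS, hSU⟩ := ih (U := U.erase m) (by
      intro x hx
      have := hU (Finset.mem_of_mem_erase hx)
      have := Finset.ne_of_mem_erase hx
      simp at *
      omega)
    rw [subsets_succ]
    by_cases hm : m ∈ U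
    · exact ⟨m :: S, by simp [hS], by simp [hSU, hm]⟩
    · exact ⟨S, by simp [hS], by simp [hSU, hm]⟩

lemma mem_candidates (hS : S ∈ candidates r m) :
    S.Nodup ∧ S.length = r ∧ ∀ i ∈ S, i < m := by
  simp only [candidates, List.mem_filter, decide_eq_true_eq] at hS
  exact ⟨(mem_subsets hS.1).1, hS.2, (mem_subsets hS.1).2⟩

lemma exists_mem_candidates {U : Finset ℕ} (hU : U ⊆ Finset.range m) (hr : U.card = r) :
    ∃ S ∈ candidates r m, S.toFinset = U := by
  obtain ⟨S, hS, rfl⟩ := exists_mem_subsets hU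
  refine ⟨S, ?_, rfl⟩
  rw [List.toFinset_card_of_nodup (mem_subsets hS).1] at hr
  simp [candidates, hS, hr]

end Lists

/-! ### Costs and optimal solutions -/

section Best

variable {k m t : ℕ} {w w' : ℕ → ℕ → ℕ} {S T : List ℕ}

lemma listCost_anti (hS : S ≠ []) (h : S ⊆ T) : listCost w t T ≤ listCost w t S :=
  Finset.sum_le_sum fun _ _ => near_anti hS h

lemma listCost_mono {s : ℕ} (h : s ≤ t) : listCost w s S ≤ listCost w t S :=
  Finset.sum_le_sum_of_subset (Finset.range_mono h)

lemma listCost_succ : listCost w (t + 1) S = listCost w t S + near (w t) S :=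
  Finset.sum_range_succ _ _

lemma listCost_congr (hS : S ≠ []) (h : ∀ j < t, ∀ i ∈ S, w j i = w' j i) :
    listCost w t S = listCost w' t S :=
  Finset.sum_congr rfl fun j hj => near_congr hS (h j (Finset.mem_range.1 hj))

lemma candidates_ne_nil : candidates (min k m) m ≠ [] := by
  obtain ⟨S, hS, -⟩ := exists_mem_candidates (U := Finset.range (min k m)) (m := m)
    (Finset.range_mono (min_le_right _ _)) (Finset.card_range _)
  exact List.ne_nil_of_mem hS

lemma best_mem : best k m w t ∈ candidates (min k m) m := argmin_mem _ candidates_ne_nil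

lemma length_best : (best k m w t).length = min k m := (mem_candidates best_mem).2.1

lemma lt_of_mem_best {i : ℕ} (hi : i ∈ best k m w t) : i < m := (mem_candidates best_mem).2.2 i hi

lemma best_ne_nil (hk : 1 ≤ k) (hm : 1 ≤ m) : best k m w t ≠ [] := by
  rw [← List.length_pos_iff, length_best]
  omega

/-- The search covers only sets of exactly `min k m` medians. A smaller set can be padded to that
size, and extra medians never raise the cost. -/
lemma bestCost_le (hS : S ≠ []) (hk : S.length ≤ k) (hm : ∀ i ∈ S, i < m) :
    bestCost k m w t ≤ listCost w t S := by
  have hsub : S.toFinset ⊆ Finset.range m := fun i hi => by simpa using hm i (by simpa using hi)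
  have hcard : S.toFinset.card ≤ min k m :=
    le_min ((List.toFinset_card_le S).trans hk) (by simpa using Finset.card_le_card hsub)
  obtain ⟨U, hSU, hU, hUc⟩ := Finset.exists_subsuperset_card_eq hsub hcard (by simp)
  obtain ⟨T, hT, rfl⟩ := exists_mem_candidates hU hUc
  refine (apply_argmin_le hT).trans (listCost_anti hS fun i hi => ?_)
  simpa using hSU (by simpa using hi)

lemma best_congr (hk : 1 ≤ k) (hm : 1 ≤ m) (h : ∀ j < t, ∀ i < m, w j i = w' j i) :
    best k m w t = best k m w' t := by
  refine argmin_congr fun S hS => listCost_congr ?_ fun j hj i hi =>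
    h j hj i ((mem_candidates hS).2.2 i hi)
  rw [← List.length_pos_iff, (mem_candidates hS).2.1]
  omega

end Best

/-! ### Analysis of the algorithm -/

/-- The properties of the distances `w` between clients and potential medians that the analysis
uses, when the potential medians at time `t` are `0, …, m t - 1`. -/
structure Regular (k n : ℕ) (m : ℕ → ℕ) (w : ℕ → ℕ → ℕ) : Prop where
  one_le : 1 ≤ k
  pos : ∀ t, 1 ≤ t → 1 ≤ m t
  mono : Monotone m
  quad : ∀ j < n, ∀ j' < n, ∀ i < m n, ∀ i' < m n, w j i ≤ w j i' + w j' i' + w j' i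
  bestCost_le : ∀ s t, s ≤ t → t ≤ n → bestCost k (m s) w s ≤ 2 * bestCost k (m t) w t

/-- At the arrival of client `t` the current solution has the wrong size. -/
def Forced (k : ℕ) (m : ℕ → ℕ) (w : ℕ → ℕ → ℕ) (t : ℕ) : Prop :=
  (sol k m w t).length ≠ min k (m (t + 1))

/-- At the arrival of client `t` the current solution has the right size but is too expensive. -/
def Late (k : ℕ) (m : ℕ → ℕ) (w : ℕ → ℕ → ℕ) (t : ℕ) : Prop :=
  (sol k m w t).length = min k (m (t + 1)) ∧
    8 * bestCost k (m (t + 1)) w (t + 1) < listCost w (t + 1) (sol k m w t)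

/-- The largest optimum up to time `t`. -/
def peak (k : ℕ) (m : ℕ → ℕ) (w : ℕ → ℕ → ℕ) (t : ℕ) : ℕ :=
  (Finset.range (t + 1)).sup fun s => bestCost k (m s) w s

/-- The number of the phase to which time `t` belongs. -/
def phase (k : ℕ) (m : ℕ → ℕ) (w : ℕ → ℕ → ℕ) (t : ℕ) : ℕ := Nat.log 2 (peak k m w t)

/-- The number of `j' < j` in the same class as `j`. -/
def rank (a : ℕ → ℕ) (j : ℕ) : ℕ := ((Finset.range j).filter fun j' => a j' = a j).card

/-- The members of a class have ranks 0, 1, 2, … in order of arrival. Hence a bound in terms of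
ranks sums to the same initial segment for every class of a given size. -/
lemma sum_rank_fiber (a : ℕ → ℕ) (g : ℕ → ℝ) (v n : ℕ) :
    ∑ j ∈ (Finset.range n).filter (fun j => a j = v), g (rank a j) =
      ∑ i ∈ Finset.range ((Finset.range n).filter fun j => a j = v).card, g i := by
  induction n with
  | zero => simp
  | succ n ih =>
    rw [Finset.range_add_one, Finset.filter_insert]
    split_ifs with h
    · rw [Finset.sum_insert (by simp), Finset.card_insert_of_notMem (by simp),
        Finset.sum_range_succ, ih, add_comm]
      congr 2
      rw [rank, h]
    · exact ih

lemma sum_rank_le {a : ℕ → ℕ} {g : ℕ → ℝ} {n : ℕ} {s : Finset ℕ} (hg : ∀ i, 0 ≤ g i)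
    (ha : ∀ j < n, a j ∈ s) :
    ∑ j ∈ Finset.range n, g (rank a j) ≤ s.card * ∑ i ∈ Finset.range n, g i := by
  rw [← Finset.sum_fiberwise_of_maps_to (t := s) (g := a) (fun j hj => ha j (by simpa using hj)),
    ← nsmul_eq_mul]
  refine Finset.sum_le_card_nsmul _ _ _ fun v _ => ?_
  rw [sum_rank_fiber]
  refine Finset.sum_le_sum_of_subset_of_nonneg (Finset.range_mono ?_) fun _ _ _ => hg _
  simpa using Finset.card_filter_le (Finset.range n) fun j => a j = v

section Analysis

variable {k n : ℕ} {m : ℕ → ℕ} {w : ℕ → ℕ → ℕ} {t : ℕ}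

lemma sol_succ_of_not (hf : ¬ Forced k m w t) (hl : ¬ Late k m w t) :
    sol k m w (t + 1) = sol k m w t := by
  unfold Forced at hf
  unfold Late at hl
  rw [sol_succ, if_pos]
  push Not at hf hl
  exact ⟨hf, hl hf⟩

lemma sol_succ_of_late (hl : Late k m w t) :
    sol k m w (t + 1) = best k (m (t + 1)) w (t + 1) := by
  rw [sol_succ, if_neg]
  exact fun h => absurd hl.2 (not_lt.2 h.2)

lemma length_sol_succ : (sol k m w (t + 1)).length = min k (m (t + 1)) := by
  rw [sol_succ]
  split_ifs with h
  · exact h.1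
  · exact length_best

lemma length_sol (ht : 1 ≤ t) : (sol k m w t).length = min k (m t) := by
  obtain ⟨t, rfl⟩ := Nat.exists_eq_add_of_le' ht
  exact length_sol_succ

lemma listCost_sol_le : listCost w t (sol k m w t) ≤ 8 * bestCost k (m t) w t := by
  cases t with
  | zero => simp [listCost]
  | succ t =>
    rw [sol_succ]
    split_ifs with h
    · exact h.2
    · have : listCost w (t + 1) (best k (m (t + 1)) w (t + 1)) =
        bestCost k (m (t + 1)) w (t + 1) := rfl
      omega

lemma sol_nodup : (sol k m w t).Nodup := by
  induction t with
  | zero => simp [sol_zero]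
  | succ t ih =>
    rw [sol_succ]
    split_ifs
    · exact ih
    · exact (mem_candidates best_mem).1

lemma lt_of_mem_sol (hm : Monotone m) {i : ℕ} (hi : i ∈ sol k m w t) : i < m t := by
  induction t with
  | zero => simp [sol_zero] at hi
  | succ t ih =>
    rw [sol_succ] at hi
    split_ifs at hi
    · exact (ih hi).trans_le (hm t.le_succ)
    · exact lt_of_mem_best hi

/-- The algorithm consults only distances between arrived clients and available medians. This
transfers the analysis from the true distances to the table decoded from the input, which has
default values elsewhere. -/
lemma sol_congr {m' : ℕ → ℕ} {w' : ℕ → ℕ → ℕ} (hk : 1 ≤ k) (hpos : ∀ t, 1 ≤ t → 1 ≤ m t)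
    (hm : Monotone m) (hw : ∀ j < t, ∀ i < m t, w j i = w' j i)
    (hmm : ∀ s ≤ t, m s = m' s) : sol k m w t = sol k m' w' t := by
  induction t with
  | zero => rfl
  | succ t ih =>
    have ih' := ih (fun j hj i hi => hw j (hj.trans t.lt_succ_self) i (hi.trans_le (hm t.le_succ)))
      fun s hs => hmm s (hs.trans t.le_succ)
    have hm1 := hpos (t + 1) (by omega)
    have hb := best_congr hk hm1 hw
    have hbc : bestCost k (m (t + 1)) w (t + 1) = bestCost k (m (t + 1)) w' (t + 1) := by
      unfold bestCost
      rw [← hb]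
      exact listCost_congr (best_ne_nil hk hm1) fun j hj i hi => hw j hj i (lt_of_mem_best hi)
    rw [sol_succ, sol_succ, ← ih', ← hmm (t + 1) le_rfl, ← hbc, ← hb]
    by_cases h0 : sol k m w t = []
    · have h1 : ¬ (sol k m w t).length = min k (m (t + 1)) := by
        rw [h0, List.length_nil]
        omega
      rw [if_neg fun h => h1 h.1, if_neg fun h => h1 h.1]
    · rw [listCost_congr h0 fun j hj i hi => hw j hj i
        ((lt_of_mem_sol hm hi).trans_le (hm t.le_succ))]

lemma bestCost_le_peak {s : ℕ} (h : s ≤ t) : bestCost k (m s) w s ≤ peak k m w t :=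
  Finset.le_sup (f := fun s => bestCost k (m s) w s) (by simpa [Nat.lt_succ_iff] using h)

lemma peak_mono : Monotone (peak k m w) := fun _ _ h =>
  Finset.sup_mono (Finset.range_mono (Nat.succ_le_succ h))

lemma phase_mono : Monotone (phase k m w) := fun _ _ h => Nat.log_mono_right (peak_mono h)

lemma peak_lt : peak k m w t < 2 * 2 ^ phase k m w t := by
  rw [← pow_succ']
  exact Nat.lt_pow_succ_log_self one_lt_two _

/-- The maximum with 1 covers a zero peak, since `Nat.log 2 0 = 0` puts it in phase 0. -/
lemma pow_phase_le : 2 ^ phase k m w t ≤ max (peak k m w t) 1 := by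
  rcases Nat.eq_zero_or_pos (peak k m w t) with h | h
  · simp [phase, h]
  · exact (Nat.pow_log_le_self 2 h.ne').trans (le_max_left _ _)

open Classical in
lemma totalRecourse_sol_le (hn : 1 ≤ n) :
    totalRecourse (fun t => (sol k m w t).toFinset) n ≤
      k * (((Finset.range n).filter (Late k m w)).card +
        ((Finset.range n).filter (Forced k m w)).card) := by
  have key : ∀ t, ((sol k m w (t + 1)).toFinset \ (sol k m w t).toFinset).card ≤
      k * ((if Late k m w t then 1 else 0) + (if Forced k m w t then 1 else 0)) := by
    intro t
    have hle : ((sol k m w (t + 1)).toFinset \ (sol k m w t).toFinset).card ≤ k := by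
      refine (Finset.card_le_card Finset.sdiff_subset).trans
        ((List.toFinset_card_le _).trans ?_)
      rw [length_sol_succ]
      exact min_le_left _ _
    by_cases hf : Forced k m w t
    · rw [if_pos hf]
      exact hle.trans (Nat.le_mul_of_pos_right k (by omega))
    · by_cases hl : Late k m w t
      · rw [if_pos hl]
        exact hle.trans (Nat.le_mul_of_pos_right k (by omega))
      · simp [sol_succ_of_not hf hl]
  have hrange : Finset.range n = Finset.Ico 0 n := by rw [Finset.range_eq_Ico]
  rw [Finset.card_filter, Finset.card_filter, ← Finset.sum_add_distrib, Finset.mul_sum, hrange,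
    Finset.sum_eq_sum_Ico_succ_bot (by omega), totalRecourse]
  refine add_le_add ?_ (Finset.sum_le_sum fun t _ => key t)
  -- The medians opened at time 1 are charged to the step from the empty solution at time 0.
  simpa [sol_zero] using key 0

/-! ### Amortized analysis of regular instances -/

variable (h : Regular k n m w)
include h

lemma Regular.peak_le (ht : t ≤ n) : peak k m w t ≤ 2 * bestCost k (m t) w t :=
  Finset.sup_le fun s hs => h.bestCost_le s t (by simpa [Nat.lt_succ_iff] using hs) ht

lemma Regular.sol_ne_nil (hf : ¬ Forced k m w t) : sol k m w t ≠ [] := by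
  unfold Forced at hf
  push Not at hf
  have := h.pos (t + 1) (by omega)
  have := h.one_le
  rw [← List.length_pos_iff]
  omega

/-- Each earlier client `j'` in the `O`-cluster of `t` offers a detour from `t` to its own nearest
median in `S`, via the common cluster center and `j'`. Summing these bounds, the terms of the
various `j'` are parts of the total costs of `O` and `S`. -/
lemma Regular.rank_mul_near_le (ht : t < n) {b : ℕ} {O S : List ℕ} (htb : t ≤ b)
    (hO : ∀ i ∈ O, i < m n) (hO' : O ≠ []) (hS : ∀ i ∈ S, i < m n) (hS' : S ≠ []) :
    rank (fun j => argmin (w j) O) t * near (w t) S ≤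
      rank (fun j => argmin (w j) O) t * near (w t) O + (listCost w b O + listCost w t S) := by
  set a := fun j => argmin (w j) O with ha
  set P := (Finset.range t).filter fun j' => a j' = a t with hP
  have hPr : P ⊆ Finset.range t := Finset.filter_subset _ _
  have key : ∀ j' ∈ P, near (w t) S ≤ near (w t) O + (near (w j') O + near (w j') S) := by
    intro j' hj'
    rw [hP, Finset.mem_filter, Finset.mem_range] at hj'
    have hs : argmin (w j') S ∈ S := argmin_mem _ hS'
    have hq := h.quad t ht j' (hj'.1.trans ht) _ (hS _ hs) (a t) (hO _ (argmin_mem _ hO'))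
    have e1 : near (w t) O = w t (a t) := rfl
    have e2 : near (w j') O = w j' (a t) := by rw [← hj'.2]; rfl
    have e3 : near (w j') S = w j' (argmin (w j') S) := rfl
    have := near_le (w := w t) hs
    omega
  have hsum := Finset.sum_le_sum key
  rw [Finset.sum_const, Finset.sum_add_distrib, Finset.sum_const, Finset.sum_add_distrib,
    smul_eq_mul, smul_eq_mul] at hsum
  have h1 : ∑ j' ∈ P, near (w j') O ≤ listCost w b O :=
    Finset.sum_le_sum_of_subset (hPr.trans (Finset.range_mono htb))
  have h2 : ∑ j' ∈ P, near (w j') S ≤ listCost w t S := Finset.sum_le_sum_of_subset hPr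
  exact hsum.trans (Nat.add_le_add le_rfl (Nat.add_le_add h1 h2))

open Classical in
/-- The amortized cost of the arrival of client `t`, compared to a solution `O` that is good for
the whole phase. -/
lemma Regular.step (ht : t < n) {b : ℕ} {O : List ℕ} (htb : t ≤ b)
    (hO : ∀ i ∈ O, i < m n) (hO' : O ≠ [])
    (hOc : listCost w b O ≤ 2 * 2 ^ phase k m w (t + 1)) :
    (listCost w (t + 1) (sol k m w (t + 1)) : ℝ) / 2 ^ phase k m w (t + 1) +
        (if Late k m w t then 1 else 0) ≤
      (listCost w t (sol k m w t) : ℝ) / 2 ^ phase k m w t +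
        ((near (w t) O : ℝ) / 2 ^ phase k m w (t + 1) +
          (if rank (fun j => argmin (w j) O) t = 0 then 16 else
            18 / (rank (fun j => argmin (w j) O) t : ℝ))) +
        16 * (if Forced k m w t then 1 else 0) := by
  set r := rank (fun j => argmin (w j) O) t with hr
  have hmono : (listCost w t (sol k m w t) : ℝ) / 2 ^ phase k m w (t + 1) ≤
      (listCost w t (sol k m w t) : ℝ) / 2 ^ phase k m w t := by
    gcongr
    · norm_num
    · exact phase_mono t.le_succ
  -- Phases never decrease, so the old cost may be divided by the new power `G`; the potential only
  -- drops when a phase ends.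
  refine le_trans ?_ (add_le_add_left (add_le_add_left hmono _) _)
  have hlt := peak_lt (k := k) (m := m) (w := w) (t := t + 1)
  have hle := pow_phase_le (k := k) (m := m) (w := w) (t := t + 1)
  generalize hG : 2 ^ phase k m w (t + 1) = G at hlt hle hOc
  have hGr : (2 : ℝ) ^ phase k m w (t + 1) = G := by rw [← hG]; push_cast; rfl
  rw [hGr]
  have hG0 : 0 < G := by rw [← hG]; positivity
  have hG0' : (0 : ℝ) < G := by exact_mod_cast hG0
  have hb := bestCost_le_peak (k := k) (m := m) (w := w) (le_refl (t + 1))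
  have hb' : bestCost k (m t) w t ≤ peak k m w (t + 1) := bestCost_le_peak t.le_succ
  have hp := h.peak_le (t := t + 1) ht
  have hc := listCost_sol_le (k := k) (m := m) (w := w) (t := t + 1)
  have hc' := listCost_sol_le (k := k) (m := m) (w := w) (t := t)
  have hlate : Late k m w t → listCost w (t + 1) (sol k m w (t + 1)) =
      bestCost k (m (t + 1)) w (t + 1) := fun hl => by rw [sol_succ_of_late hl]; rfl
  rw [div_add' _ _ _ hG0'.ne', div_le_iff₀ hG0', add_mul, add_mul, add_mul,
    div_mul_cancel₀ _ hG0'.ne', div_mul_cancel₀ _ hG0'.ne']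
  by_cases hf : Forced k m w t
  · have hl : ¬ Late k m w t := fun hl => hf hl.1
    rw [if_neg hl, if_pos hf]
    -- The new cost is at most 8 times the optimum, and the optimum is below `2 * G`.
    have h16 : (listCost w (t + 1) (sol k m w (t + 1)) : ℝ) ≤ 16 * G := by
      exact_mod_cast (by omega : listCost w (t + 1) (sol k m w (t + 1)) ≤ 16 * G)
    have : (0 : ℝ) ≤ if r = 0 then 16 else 18 / (r : ℝ) := by split_ifs <;> positivity
    have : (0 : ℝ) ≤ (if r = 0 then 16 else 18 / (r : ℝ)) * G := by positivity
    have : (0 : ℝ) ≤ near (w t) O := by positivity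
    have : (0 : ℝ) ≤ listCost w t (sol k m w t) := by positivity
    linarith
  · rw [if_neg hf]
    have hX := listCost_succ (w := w) (t := t) (S := sol k m w t)
    by_cases hr0 : r = 0
    · rw [if_pos hr0]
      have : (0 : ℝ) ≤ near (w t) O := by positivity
      have : (0 : ℝ) ≤ listCost w t (sol k m w t) := by positivity
      -- The first client of a cluster has no predecessor to route through, so the whole new cost is
      -- paid for. After a late switch that cost is an optimum, below `2 * G`, which leaves room for
      -- the extra `G`.
      have h16 : (listCost w (t + 1) (sol k m w (t + 1)) : ℝ) +
          (if Late k m w t then 1 else 0) * G ≤ 16 * G := by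
        split_ifs with hl
        · have := hlate hl
          exact_mod_cast (by omega : listCost w (t + 1) (sol k m w (t + 1)) + 1 * G ≤ 16 * G)
        · rw [zero_mul, add_zero]
          exact_mod_cast (by omega : listCost w (t + 1) (sol k m w (t + 1)) ≤ 16 * G)
      linarith
    · rw [if_neg hr0]
      have hrpos : (0 : ℝ) < r := by exact_mod_cast Nat.pos_of_ne_zero hr0
      have hrank := h.rank_mul_near_le ht htb hO hO'
        (fun i hi => (lt_of_mem_sol h.mono hi).trans_le (h.mono ht.le)) (h.sol_ne_nil hf)
      rw [← hr] at hrank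
      -- Here 18 = 2 + 16: `O` costs at most `2 * G`, and the current solution at most 8 times an
      -- optimum below `2 * G`.
      have hrank' : r * near (w t) (sol k m w t) ≤ r * near (w t) O + 18 * G := by omega
      have hΔ : (near (w t) (sol k m w t) : ℝ) ≤ near (w t) O + 18 / r * G := by
        have : (r : ℝ) * near (w t) (sol k m w t) ≤ r * near (w t) O + 18 * G := by
          exact_mod_cast hrank'
        refine le_of_mul_le_mul_left (this.trans_eq ?_) hrpos
        field_simp
      have hstep : (listCost w (t + 1) (sol k m w (t + 1)) : ℝ) +
          (if Late k m w t then 1 else 0) * G ≤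
            listCost w t (sol k m w t) + near (w t) (sol k m w t) := by
        split_ifs with hl
        · have h1 := hlate hl
          have h2 := hl.2
          -- The switch saves more than 7 optima. If the peak is positive, the optimum is at least
          -- `G / 2`; if it is zero, then `G = 1` and integrality makes the saving at least 1.
          exact_mod_cast (by omega : listCost w (t + 1) (sol k m w (t + 1)) + 1 * G ≤
            listCost w t (sol k m w t) + near (w t) (sol k m w t))
        · rw [zero_mul, add_zero, sol_succ_of_not hf hl, hX]
          push_cast
          rfl
      linarith

-- The required size `min k (m t)` never decreases, so every forced step makes the solution strictly
-- longer, including the first step from the empty list.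
open Classical in
lemma Regular.card_forced_le_length :
    ((Finset.range t).filter (Forced k m w)).card ≤ (sol k m w t).length := by
  induction t with
  | zero => simp
  | succ t ih =>
    rw [Finset.range_add_one, Finset.filter_insert]
    have hlen := length_sol_succ (k := k) (m := m) (w := w) (t := t)
    split_ifs with hf
    · rw [Finset.card_insert_of_notMem (by simp)]
      unfold Forced at hf
      have : (sol k m w t).length ≤ min k (m (t + 1)) := by
        rcases Nat.eq_zero_or_pos t with rfl | ht
        · simp [sol_zero]
        · rw [length_sol ht]
          have := h.mono t.le_succ
          simp only [Nat.succ_eq_add_one] at this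
          omega
      omega
    · unfold Forced at hf
      push Not at hf
      omega

open Classical in
lemma Regular.card_forced_le : ((Finset.range t).filter (Forced k m w)).card ≤ k := by
  refine h.card_forced_le_length.trans ?_
  cases t with
  | zero => simp [sol_zero]
  | succ t => exact length_sol_succ.trans_le (min_le_left _ _)

lemma Regular.sum_phase_le (hn : 1 ≤ n) (q : ℕ) :
    ∃ O : List ℕ, (∀ i ∈ O, i < m n) ∧ O ≠ [] ∧
      (∀ t < n, phase k m w (t + 1) = q → ∃ b, t ≤ b ∧ listCost w b O ≤ 2 * 2 ^ q) ∧
      ∑ t ∈ (Finset.range n).filter (fun t => phase k m w (t + 1) = q),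
        ((near (w t) O : ℝ) / 2 ^ q +
          (if rank (fun j => argmin (w j) O) t = 0 then 16 else
            18 / (rank (fun j => argmin (w j) O) t : ℝ))) ≤
        2 + k * (34 + 18 * Real.log n) := by
  -- `b` is the last time in phase `q`. Its optimum `O` serves as the reference solution for all
  -- arrivals leading into a time of this phase.
  set b := Nat.findGreatest (fun s => phase k m w s = q) n with hb
  have hbn : b ≤ n := Nat.findGreatest_le n
  have hlog : 0 ≤ Real.log n := Real.log_natCast_nonneg n
  by_cases hT : ∃ t < n, phase k m w (t + 1) = q
  swap
  · refine ⟨best k (m n) w n, fun i hi => lt_of_mem_best hi,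
      best_ne_nil h.one_le (h.pos n hn), fun t ht hq => absurd ⟨t, ht, hq⟩ hT, ?_⟩
    rw [Finset.sum_eq_zero]
    · positivity
    · intro t ht
      rw [Finset.mem_filter, Finset.mem_range] at ht
      exact absurd ⟨t, ht⟩ hT
  obtain ⟨t₀, ht₀, hq₀⟩ := hT
  have hbq : phase k m w b = q := Nat.findGreatest_spec (P := fun s => phase k m w s = q) ht₀ hq₀
  have hlast : ∀ t < n, phase k m w (t + 1) = q → t < b := fun t ht hq =>
    Nat.le_findGreatest (P := fun s => phase k m w s = q) ht hq
  have hb1 : 1 ≤ b := (Nat.zero_le _).trans_lt (hlast t₀ ht₀ hq₀)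
  set O := best k (m b) w b with hO
  have hOc : listCost w b O ≤ 2 * 2 ^ q := by
    have h1 := bestCost_le_peak (k := k) (m := m) (w := w) (le_refl b)
    have h2 := peak_lt (k := k) (m := m) (w := w) (t := b)
    rw [hbq] at h2
    exact h1.trans h2.le
  have hOne : O ≠ [] := best_ne_nil h.one_le (h.pos b hb1)
  refine ⟨O, fun i hi => (lt_of_mem_best hi).trans_le (h.mono hbn), hOne,
    fun t ht hq => ⟨b, (hlast t ht hq).le, hOc⟩, ?_⟩
  rw [Finset.sum_add_distrib]
  refine add_le_add ?_ ?_
  · rw [← Finset.sum_div, div_le_iff₀ (by positivity)]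
    have : ∑ t ∈ (Finset.range n).filter (fun t => phase k m w (t + 1) = q), near (w t) O ≤
        2 * 2 ^ q := by
      refine le_trans (Finset.sum_le_sum_of_subset fun t ht => ?_) hOc
      rw [Finset.mem_filter, Finset.mem_range] at ht
      exact Finset.mem_range.2 (hlast t ht.1 ht.2)
    exact_mod_cast this
  · set g : ℕ → ℝ := fun i => if i = 0 then 16 else 18 / (i : ℝ) with hg
    have hg0 : ∀ i, 0 ≤ g i := fun i => by simp only [hg]; split_ifs <;> positivity
    -- Ranks count all earlier clients, also those before the phase, so the sum is extended to all
    -- arrivals before it is split into clusters.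
    have h1 : ∑ t ∈ (Finset.range n).filter (fun t => phase k m w (t + 1) = q),
        g (rank (fun j => argmin (w j) O) t) ≤
        ∑ t ∈ Finset.range n, g (rank (fun j => argmin (w j) O) t) :=
      Finset.sum_le_sum_of_subset_of_nonneg (Finset.filter_subset _ _) fun _ _ _ => hg0 _
    have h2 := sum_rank_le (a := fun j => argmin (w j) O) (s := O.toFinset) (n := n) hg0
      fun j _ => by simpa using argmin_mem (w j) hOne
    have h3 : (O.toFinset.card : ℝ) ≤ k := by
      have : O.length ≤ k := by
        rw [hO, length_best]
        exact min_le_left _ _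
      exact_mod_cast (List.toFinset_card_le O).trans this
    have h4 : ∑ i ∈ Finset.range n, g i ≤ 34 + 18 * Real.log n := by
      -- Rank 0 gives 16 and the others at most 18 times a harmonic number; with `harmonic n ≤ 1 +
      -- log n` the constant is 34 = 16 + 18.
      have h5 : ∑ i ∈ Finset.range n, g i ≤ 16 + 18 * (harmonic n : ℝ) := by
        obtain ⟨n, rfl⟩ := Nat.exists_eq_add_of_le' hn
        rw [Finset.sum_range_succ', harmonic, Finset.sum_range_succ]
        push_cast
        rw [mul_add, Finset.mul_sum]
        have : ∑ i ∈ Finset.range n, g (i + 1) = ∑ i ∈ Finset.range n, 18 * ((i : ℝ) + 1)⁻¹ := by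
          refine Finset.sum_congr rfl fun i _ => ?_
          simp [hg, div_eq_mul_inv]
        rw [this]
        have h6 : (0 : ℝ) ≤ 18 * ((n : ℝ) + 1)⁻¹ := by positivity
        have h7 : g 0 = 16 := by simp [hg]
        linarith
      have := harmonic_le_one_add_log n
      linarith
    refine h1.trans (h2.trans ?_)
    exact mul_le_mul h3 h4 (Finset.sum_nonneg fun i _ => hg0 i) (by positivity)

-- The amortized inequality telescopes over time. Its charges are then grouped by phase, each with
-- its own reference solution, and the forced steps add at most `16 * k`.
open Classical in
lemma Regular.card_late_le (hn : 1 ≤ n) :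
    (((Finset.range n).filter (Late k m w)).card : ℝ) ≤
      (phase k m w n + 1) * (2 + k * (34 + 18 * Real.log n)) + 16 * k := by
  choose O hO hO' hOc hsum using h.sum_phase_le hn
  set β : ℕ → ℝ := fun t => (near (w t) (O (phase k m w (t + 1))) : ℝ) /
      2 ^ phase k m w (t + 1) +
    (if rank (fun j => argmin (w j) (O (phase k m w (t + 1)))) t = 0 then 16 else
      18 / (rank (fun j => argmin (w j) (O (phase k m w (t + 1)))) t : ℝ)) with hβ
  have hind : ∀ t ≤ n, (listCost w t (sol k m w t) : ℝ) / 2 ^ phase k m w t +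
      ((Finset.range t).filter (Late k m w)).card ≤
      ∑ s ∈ Finset.range t, β s + 16 * ((Finset.range t).filter (Forced k m w)).card := by
    intro t
    induction t with
    | zero => simp [listCost]
    | succ t ih =>
      intro ht
      have ih' := ih (Nat.le_of_succ_le ht)
      obtain ⟨b, htb, hb⟩ := hOc _ t ht rfl
      have hs := h.step ht htb (hO _) (hO' _) hb
      rw [Finset.card_filter, Finset.card_filter] at *
      push_cast at *
      rw [Finset.sum_range_succ, Finset.sum_range_succ, Finset.sum_range_succ]
      change _ ≤ _ + β t + _ at hs
      linarith
  have hn' := hind n le_rfl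
  have hβsum : ∑ s ∈ Finset.range n, β s ≤
      (phase k m w n + 1) * (2 + k * (34 + 18 * Real.log n)) := by
    rw [← Finset.sum_fiberwise_of_maps_to (t := Finset.range (phase k m w n + 1))
      (g := fun t => phase k m w (t + 1)) (fun t ht => by
        rw [Finset.mem_range, Nat.lt_succ_iff]
        exact phase_mono (Finset.mem_range.1 ht))]
    refine (Finset.sum_le_card_nsmul _ _ (2 + k * (34 + 18 * Real.log n))
      fun q _ => ?_).trans_eq ?_
    · refine le_trans (le_of_eq (Finset.sum_congr rfl fun t ht => ?_)) (hsum q)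
      rw [Finset.mem_filter] at ht
      simp only [hβ, ht.2]
    · rw [Finset.card_range, nsmul_eq_mul]
      push_cast
      rfl
  have hforced : (((Finset.range n).filter (Forced k m w)).card : ℝ) ≤ k := by
    exact_mod_cast h.card_forced_le
  have : (0 : ℝ) ≤ (listCost w n (sol k m w n) : ℝ) / 2 ^ phase k m w n := by positivity
  linarith

lemma Regular.peak_le_mul {D : ℕ} (hD : ∀ j < n, ∀ i < m n, w j i ≤ D) :
    peak k m w n ≤ n * D := by
  refine Finset.sup_le fun s hs => ?_
  rw [Finset.mem_range, Nat.lt_succ_iff] at hs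
  rcases Nat.eq_zero_or_pos s with rfl | hs0
  · simp [bestCost, listCost]
  refine le_trans ?_ (Nat.mul_le_mul_right D hs)
  have hne : best k (m s) w s ≠ [] := best_ne_nil h.one_le (h.pos s hs0)
  refine (Finset.sum_le_card_nsmul (Finset.range s) _ D fun j hj => ?_).trans_eq (by simp)
  exact hD j ((Finset.mem_range.1 hj).trans_le hs) _
    ((lt_of_mem_best (argmin_mem _ hne)).trans_le (h.mono hs))

theorem Regular.totalRecourse_le_log (hn : 2 ≤ n) {D : ℕ} (hD1 : 1 ≤ D)
    (hD : ∀ j < n, ∀ i < m n, w j i ≤ D) :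
    (totalRecourse (fun t => (sol k m w t).toFinset) n : ℝ) ≤
      300 * (k : ℝ) ^ 2 * Real.log n * Real.log (n * D) := by
  classical
  have h1 := totalRecourse_sol_le (k := k) (m := m) (w := w) (by omega : 1 ≤ n)
  have h2 := h.card_late_le (by omega : 1 ≤ n)
  have h3 : (((Finset.range n).filter (Forced k m w)).card : ℝ) ≤ k := by
    exact_mod_cast h.card_forced_le
  have h1' : (totalRecourse (fun t => (sol k m w t).toFinset) n : ℝ) ≤
      k * (((Finset.range n).filter (Late k m w)).card +
        ((Finset.range n).filter (Forced k m w)).card) := by exact_mod_cast h1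
  have hk : (1 : ℝ) ≤ k := by exact_mod_cast h.one_le
  have hl2 : (0.69 : ℝ) ≤ Real.log 2 := by linarith [Real.log_two_gt_d9]
  have hx : Real.log 2 ≤ Real.log n := Real.log_le_log (by norm_num) (by exact_mod_cast hn)
  have hnD : 2 ≤ n * D := hn.trans (Nat.le_mul_of_pos_right n hD1)
  have hy : Real.log 2 ≤ Real.log (n * D) :=
    Real.log_le_log (by norm_num) (by exact_mod_cast hnD)
  have hphase : (phase k m w n : ℝ) * Real.log 2 ≤ Real.log (n * D) := by
    have hpow : 2 ^ phase k m w n ≤ n * D :=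
      pow_phase_le.trans (max_le (h.peak_le_mul hD) (by omega))
    rw [← Real.log_pow]
    exact Real.log_le_log (by positivity) (by exact_mod_cast hpow)
  set x := Real.log n
  set y := Real.log (n * D)
  have hx' : 0.69 ≤ x := hl2.trans hx
  have hy' : 0.69 ≤ y := hl2.trans hy
  have hp0 : (0 : ℝ) ≤ phase k m w n := by positivity
  -- Since `x` and `y` are at least 0.69, additive constants are absorbed: 2 / 0.69 < 3 and 36 /
  -- 0.69 + 18 < 72. The total is then at most 3 * 72 + 17 / 0.476 < 300 times `k * (x * y)`.
  have hp : (phase k m w n : ℝ) + 1 ≤ 3 * y := by nlinarith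
  have hq : 2 + k * (34 + 18 * x) ≤ k * (72 * x) := by nlinarith
  have hxy : 0.476 ≤ x * y := by nlinarith
  have h4 : ((phase k m w n : ℝ) + 1) * (2 + k * (34 + 18 * x)) ≤ 3 * y * (k * (72 * x)) :=
    mul_le_mul hp hq (by positivity) (by positivity)
  have h5 : (((Finset.range n).filter (Late k m w)).card : ℝ) +
      ((Finset.range n).filter (Forced k m w)).card ≤ k * (300 * (x * y)) := by nlinarith
  calc _ ≤ _ := h1'
    _ ≤ k * (k * (300 * (x * y))) := by gcongr
    _ = _ := by ring

end Analysis

/-! ### Instances in metric spaces -/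

section Metric

variable {X : Type*} [MetricSpace X] {F c : ℕ → X} {k n t : ℕ} {m : ℕ → ℕ} {w : ℕ → ℕ → ℕ}

lemma cost_toFinset {S : List ℕ} (hS : S ≠ [])
    (hw : ∀ j < t, ∀ i ∈ S, (w j i : ℝ) = dist (c j) (F i)) :
    cost F c t S.toFinset = listCost w t S := by
  rw [cost, listCost, Nat.cast_sum]
  refine Finset.sum_congr rfl fun j hj => ?_
  have hj' := hw j (Finset.mem_range.1 hj)
  have hmem : argmin (w j) S ∈ S := argmin_mem _ hS
  have hmem' : F (argmin (w j) S) ∈ F '' (S.toFinset : Set ℕ) := ⟨_, by simpa using hmem, rfl⟩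
  refine le_antisymm ?_ ((Metric.le_infDist ⟨_, hmem'⟩).2 ?_)
  · exact (Metric.infDist_le_dist_of_mem hmem').trans_eq (hj' _ hmem).symm
  · rintro _ ⟨i, hi, rfl⟩
    have hi' : i ∈ S := by simpa using hi
    rw [← hj' i hi']
    exact_mod_cast near_le hi'

lemma Regular.bestCost_le_opt (h : Regular k n m w) (ht1 : 1 ≤ t) (ht : t ≤ n)
    (hw : ∀ j < n, ∀ i < m n, (w j i : ℝ) = dist (c j) (F i)) :
    (bestCost k (m t) w t : ℝ) ≤ opt F c k (m t) t := by
  have hm1 := h.pos t ht1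
  have hk1 := h.one_le
  refine le_csInf ⟨_, {0}, by simp; omega, by simp, by simpa using hk1, rfl⟩ ?_
  rintro _ ⟨S, hS, hne, hcard, rfl⟩
  have hS' : ∀ i ∈ S.toList, i < m t := fun i hi => by simpa using hS (by simpa using hi)
  have hne' : S.toList ≠ [] := by simpa using hne.ne_empty
  have hcost := cost_toFinset hne' fun j (hj : j < t) i hi =>
    hw j (hj.trans_le ht) i ((hS' i hi).trans_le (h.mono ht))
  rw [Finset.toList_toFinset] at hcost
  rw [hcost]
  exact_mod_cast ConsistentKMedian.bestCost_le hne' (by simpa using hcard) hS'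

lemma one_le_diam {P : Set X} (hP : Bornology.IsBounded P) (hint : IntegerDistances P)
    (hpos : 0 < Metric.diam P) : 1 ≤ Metric.diam P := by
  by_contra hlt
  refine hpos.not_ge (Metric.diam_le_of_forall_dist_le le_rfl fun x hx y hy => ?_)
  obtain ⟨a, ha⟩ := hint x hx y hy
  have h1 := (Metric.dist_le_diam_of_mem hP hx hy).trans_lt (not_le.1 hlt)
  rw [ha] at h1 ⊢
  have : a < 1 := by exact_mod_cast h1
  have : a = 0 := by omega
  simp [this]

lemma isBounded_points (F c : ℕ → X) (m n : ℕ) : Bornology.IsBounded (points F c m n) :=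
  (((Set.finite_Iio m).image F).union ((Set.finite_Iio n).image c)).isBounded

/-- The algorithm satisfies the guarantee on every regular instance. -/
theorem Regular.guarantee (h : Regular k n m w)
    (hw : ∀ j < n, ∀ i < m n, (w j i : ℝ) = dist (c j) (F i))
    (hint : IntegerDistances (points F c (m n) n)) :
    Guarantee F c k n m 8 300 (fun t => (sol k m w t).toFinset) where
  feasible t ht := by
    rw [Finset.mem_Icc] at ht
    refine ⟨fun i hi => ?_, ?_⟩
    · simpa using lt_of_mem_sol h.mono (by simpa using hi)
    · rw [List.toFinset_card_of_nodup sol_nodup, length_sol ht.1]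
  approx t ht := by
    rw [Finset.mem_Icc] at ht
    have hne : sol k m w t ≠ [] := by
      have := h.pos t ht.1
      have := h.one_le
      rw [← List.length_pos_iff, length_sol ht.1]
      omega
    rw [cost_toFinset hne fun j hj i hi => hw j (hj.trans_le ht.2) i
      ((lt_of_mem_sol h.mono hi).trans_le (h.mono ht.2))]
    have h1 : (listCost w t (sol k m w t) : ℝ) ≤ 8 * bestCost k (m t) w t := by
      exact_mod_cast listCost_sol_le
    linarith [h.bestCost_le_opt ht.1 ht.2 hw]
  recourse hn hpos := by
    have hb := isBounded_points F c (m n) n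
    have h1 := one_le_diam hb hint hpos
    set Δ := Metric.diam (points F c (m n) n)
    -- The combinatorial bound needs a positive natural number as diameter; the floor is one because
    -- a positive diameter with integer distances is at least 1.
    have hD1 : 1 ≤ ⌊Δ⌋₊ := Nat.le_floor (by simpa using h1)
    have hD : ∀ j < n, ∀ i < m n, w j i ≤ ⌊Δ⌋₊ := fun j hj i hi => Nat.le_floor <| by
      rw [hw j hj i hi]
      exact Metric.dist_le_diam_of_mem hb (Or.inr ⟨j, hj, rfl⟩) (Or.inl ⟨i, hi, rfl⟩)
    refine (h.totalRecourse_le_log hn hD1 hD).trans ?_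
    have hn0 : (0 : ℝ) < n := by exact_mod_cast (by omega : 0 < n)
    have hD0 : (0 : ℝ) < ⌊Δ⌋₊ := by exact_mod_cast hD1
    have hlog : 0 ≤ Real.log n := Real.log_natCast_nonneg n
    have hfloor : (⌊Δ⌋₊ : ℝ) ≤ Δ := Nat.floor_le hpos.le
    gcongr

lemma floor_dist_of_integerDistances {P : Set X} (hint : IntegerDistances P) {x y : X}
    (hx : x ∈ P) (hy : y ∈ P) : (⌊dist x y⌋₊ : ℝ) = dist x y := by
  obtain ⟨a, ha⟩ := hint x hx y hy
  rw [ha, Nat.floor_natCast]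

lemma le_add_add_of_eq_dist {j j' i i' : ℕ} (h1 : (w j i : ℝ) = dist (c j) (F i))
    (h2 : (w j i' : ℝ) = dist (c j) (F i')) (h3 : (w j' i' : ℝ) = dist (c j') (F i'))
    (h4 : (w j' i : ℝ) = dist (c j') (F i)) : w j i ≤ w j i' + w j' i' + w j' i := by
  have := dist_triangle4 (c j) (F i') (c j') (F i)
  rw [dist_comm (F i') (c j'), ← h1, ← h2, ← h3, ← h4] at this
  exact_mod_cast this

end Metric

/-! ### The static setting -/

/-- The online algorithm for a static set of potential medians. -/
def staticAlgorithm (p : ℕ × ℕ × List (List ℕ)) : List ℕ :=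
  sol p.1 (fun _ => p.2.1) (fun j i => (p.2.2.getD j []).getD i 0) p.2.2.length

lemma computable_staticAlgorithm : Computable staticAlgorithm := by
  refine (primrec_sol (σ := ℕ × ℕ × List (List ℕ)) (m := fun p _ => p.2.1)
    (w := fun p j i => (p.2.2.getD j []).getD i 0) Primrec.fst
    (Primrec.fst.comp (Primrec.snd.comp Primrec.fst)) ?_
    (Primrec.list_length.comp (Primrec.snd.comp Primrec.snd))).to_comp
  refine (Primrec.list_getD 0).comp ((Primrec.list_getD []).comp
    (Primrec.snd.comp (Primrec.snd.comp Primrec.fst)) (Primrec.fst.comp Primrec.snd))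
    (Primrec.snd.comp Primrec.snd)

lemma regular_static {k n m : ℕ} {w : ℕ → ℕ → ℕ} (hk : 1 ≤ k) (hm : 1 ≤ m)
    (hquad : ∀ j < n, ∀ j' < n, ∀ i < m, ∀ i' < m, w j i ≤ w j i' + w j' i' + w j' i) :
    Regular k n (fun _ => m) w where
  one_le := hk
  pos _ _ := hm
  mono := monotone_const
  quad := hquad
  bestCost_le s t hst _ := by
    have h1 : bestCost k m w s ≤ listCost w s (best k m w t) :=
      bestCost_le (best_ne_nil hk hm) (length_best.trans_le (min_le_left _ _))
        fun i hi => lt_of_mem_best hi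
    have h2 : listCost w s (best k m w t) ≤ bestCost k m w t := listCost_mono hst
    change bestCost k m w s ≤ 2 * bestCost k m w t
    omega

theorem staticAlgorithm_spec : StaticAlgorithm 8 300 staticAlgorithm := by
  refine ⟨computable_staticAlgorithm, fun X _ F c k m n hk hm hint => ?_⟩
  set w : ℕ → ℕ → ℕ := fun j i => ⌊dist (c j) (F i)⌋₊ with hw
  have hwd : ∀ j < n, ∀ i < m, (w j i : ℝ) = dist (c j) (F i) := fun j hj i hi =>
    floor_dist_of_integerDistances hint (Or.inr ⟨j, hj, rfl⟩) (Or.inl ⟨i, hi, rfl⟩)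
  have hreg : Regular k n (fun _ => m) w := regular_static hk hm fun j hj j' hj' i hi i' hi' =>
    le_add_add_of_eq_dist (hwd j hj i hi) (hwd j hj i' hi') (hwd j' hj' i' hi') (hwd j' hj' i hi)
  have hsol : ∀ t, staticAlgorithm (k, m, revealedStatic F c m t) = sol k (fun _ => m) w t := by
    intro t
    have hlen : (revealedStatic F c m t).length = t := by simp [revealedStatic]
    simp only [staticAlgorithm, hlen]
    refine (sol_congr hk (fun _ _ => hm) monotone_const (fun j hj i hi => ?_)
      fun _ _ => rfl).symm
    simp [revealedStatic, hw, hj, hi]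
  simp only [hsol]
  exact hreg.guarantee hwd hint

/-! ### The setting in which the clients are the potential medians -/

/-- The online algorithm for the setting in which the clients are the potential medians. -/
def selfAlgorithm (p : ℕ × List (List ℕ)) : List ℕ :=
  sol p.1 (fun t => t)
    (fun j i => max ((p.2.getD j []).getD i 0) ((p.2.getD i []).getD j 0)) p.2.length

lemma computable_selfAlgorithm : Computable selfAlgorithm := by
  refine (primrec_sol (σ := ℕ × List (List ℕ)) (m := fun _ t => t)
    (w := fun p j i => max ((p.2.getD j []).getD i 0) ((p.2.getD i []).getD j 0)) Primrec.fst
    Primrec.snd ?_ (Primrec.list_length.comp Primrec.snd)).to_comp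
  have hL : Primrec fun q : (ℕ × List (List ℕ)) × ℕ × ℕ => q.1.2 :=
    Primrec.snd.comp Primrec.fst
  have hj : Primrec fun q : (ℕ × List (List ℕ)) × ℕ × ℕ => q.2.1 :=
    Primrec.fst.comp Primrec.snd
  have hi : Primrec fun q : (ℕ × List (List ℕ)) × ℕ × ℕ => q.2.2 :=
    Primrec.snd.comp Primrec.snd
  exact Primrec.nat_max.comp
    ((Primrec.list_getD 0).comp ((Primrec.list_getD []).comp hL hj) hi)
    ((Primrec.list_getD 0).comp ((Primrec.list_getD []).comp hL hi) hj)

/-- For quasi-monotonicity, each median of a later optimum is replaced by the closest client of its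
cluster among the first `s` arrivals. For a client of the cluster the detour through the old median
at most doubles the distance. -/
lemma regular_self {k n : ℕ} {w : ℕ → ℕ → ℕ} (hk : 1 ≤ k) (hself : ∀ i, w i i = 0)
    (hquad : ∀ j < n, ∀ j' < n, ∀ i < n, ∀ i' < n, w j i ≤ w j i' + w j' i' + w j' i) :
    Regular k n (fun t => t) w where
  one_le := hk
  pos _ ht := ht
  mono := monotone_id
  quad := hquad
  bestCost_le s t hst htn := by
    rcases Nat.eq_zero_or_pos s with rfl | hs
    · simp [bestCost, listCost]
    set O := best k t w t with hO
    have hne : O ≠ [] := best_ne_nil hk (hs.trans_le hst)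
    set cl : ℕ → List ℕ := fun o => (List.range s).filter fun j => argmin (w j) O = o with hcl
    set v : ℕ → ℕ := fun o => argmin (fun j => w j o) (cl o) with hv
    have hvs : ∀ o, v o < s := by
      intro o
      -- For an empty cluster `argmin` returns the default index 0, which is a client that has
      -- arrived since `s` is positive.
      by_cases h0 : cl o = []
      · have : v o = 0 := by simp only [hv, h0]; rfl
        omega
      · have h1 : v o ∈ cl o := argmin_mem _ h0
        simp only [hcl, List.mem_filter, List.mem_range] at h1
        exact h1.1
    have hcost : bestCost k s w s ≤ listCost w s (O.map v) := by
      refine bestCost_le (by simpa using hne) ?_ fun i hi => ?_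
      · rw [List.length_map, hO, length_best]
        exact min_le_left _ _
      · obtain ⟨o, -, rfl⟩ := List.mem_map.1 hi
        exact hvs o
    have hdouble : listCost w s (O.map v) ≤ 2 * listCost w s O := by
      rw [listCost, listCost, Finset.mul_sum]
      refine Finset.sum_le_sum fun j hj => ?_
      rw [Finset.mem_range] at hj
      have hmem : argmin (w j) O ∈ O := argmin_mem _ hne
      have hnear : near (w j) O = w j (argmin (w j) O) := rfl
      have h1 : near (w j) (O.map v) ≤ w j (v (argmin (w j) O)) :=
        near_le (List.mem_map_of_mem hmem)
      have hjc : j ∈ cl (argmin (w j) O) := by simp [hcl, hj]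
      have h2 : w (v (argmin (w j) O)) (argmin (w j) O) ≤ w j (argmin (w j) O) :=
        apply_argmin_le (f := fun j' => w j' (argmin (w j) O)) hjc
      have hv' := ((hvs (argmin (w j) O)).trans_le hst).trans_le htn
      have h3 := hquad j ((hj.trans_le hst).trans_le htn) _ hv' _ hv' (argmin (w j) O)
        ((lt_of_mem_best hmem).trans_le htn)
      rw [hself] at h3
      omega
    have hmono : listCost w s O ≤ bestCost k t w t := listCost_mono hst
    change bestCost k s w s ≤ 2 * bestCost k t w t
    omega

theorem selfAlgorithm_spec : SelfAlgorithm 8 300 selfAlgorithm := by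
  refine ⟨computable_selfAlgorithm, fun X _ c k n hk hint => ?_⟩
  set w : ℕ → ℕ → ℕ := fun j i => ⌊dist (c j) (c i)⌋₊ with hw
  have hwd : ∀ j < n, ∀ i < n, (w j i : ℝ) = dist (c j) (c i) := fun j hj i hi =>
    floor_dist_of_integerDistances hint (Or.inr ⟨j, hj, rfl⟩) (Or.inl ⟨i, hi, rfl⟩)
  have hreg : Regular k n (fun t => t) w :=
    regular_self hk (fun i => by simp [hw]) fun j hj j' hj' i hi i' hi' =>
      le_add_add_of_eq_dist (hwd j hj i hi) (hwd j hj i' hi') (hwd j' hj' i' hi')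
        (hwd j' hj' i hi)
  have hsol : ∀ t, selfAlgorithm (k, revealedSelf c t) = sol k (fun t => t) w t := by
    intro t
    have hlen : (revealedSelf c t).length = t := by simp [revealedSelf]
    simp only [selfAlgorithm, hlen]
    refine (sol_congr hk (fun _ ht => ht) monotone_id (fun j hj i hi => ?_)
      fun _ _ => rfl).symm
    -- Only the triangle `i < j` of the distance table is revealed. Of the two lookups one is the
    -- default 0, so their maximum is the symmetric distance, with 0 on the diagonal.
    rcases lt_trichotomy i j with hij | rfl | hij
    · simp [revealedSelf, hw, hj, hi, hij, hij.le]
    · simp [revealedSelf, hw, hj]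
    · simp [revealedSelf, hw, hj, hi, hij, hij.le, dist_comm (c j) (c i)]
  simp only [hsol]
  exact hreg.guarantee hwd hint

end ConsistentKMedian

theorem mainTheorem3 :
    ∃ α B : ℝ,
      (∃ A : ℕ × ℕ × List (List ℕ) → List ℕ, ConsistentKMedian.StaticAlgorithm α B A) ∧
      (∃ A : ℕ × List (List ℕ) → List ℕ, ConsistentKMedian.SelfAlgorithm α B A) :=
  ⟨8, 300, ⟨_, ConsistentKMedian.staticAlgorithm_spec⟩, ⟨_, ConsistentKMedian.selfAlgorithm_spec⟩⟩
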